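/- **Setting.** Let $\mathcal H_A,\mathcal H_B$ be complex Hilbert spaces of finite dimensions $d_A,d_B$, and let $|\Psi\rangle=\sum_{x\in\mathcal X}\sqrt{\lambda_x}\,|x\rangle_A\otimes|x\rangle_B$ be a Schmidt decomposition of a unit vector of $\mathcal H_A\otimes\mathcal H_B$: $\mathcal X$ is a finite set, $\{|x\rangle_A\}_x$ and $\{|x\rangle_B\}_x$ are orthonormal families, $\lambda_x\ge 0$, $\sum_x\lambda_x=1$. Put $\rho_{mix}=I/(d_Ad_B)$ and $H_\alpha(\Psi)=\frac{1}{1-\alpha}\log\sum_{x:\lambda_x>0}\lambda_x^{\alpha}$ for $\alpha\ne 1$, with $H_\alpha'(\Psi)=\frac{d}{d\alpha}H_\alpha(\Psi)$. Let $\mathcal T_n$ be the set of empirical distributions $y\mapsto \#\{i: x_i=y\}/n$ of sequences $(x_1,\dots,x_n)\in\mathcal X^n$. For $\vec x\in\mathcal X^n$ write $|\vec x\rangle=|x_1\rangle\otimes\cdots\otimes|x_n\rangle$ (on Alice's or Bob's side). **Protocol.** Let $\{m_\omega\}_{\omega\subset\mathcal X^n}$ be non-negative measures on $\mathcal X^n$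 with $\sum_\omega m_\omega(\vec x)\le 1$ for all $\vec x$, such that for each $\omega$ either $m_\omega=0$ or $m_\omega$ has support exactly $\omega$. Put $M_\omega=\sum_{\vec x}m_\omega(\vec x)|\vec x\rangle\langle\vec x|$ on $\mathcal H_A^{\otimes n}$ and $\sigma_A=\mathrm{Tr}_B\,|\Psi\rangle\langle\Psi|^{\otimes n}$. For every $\omega$ let $\{\xi^\omega_j\}_{j=1}^{|\omega|}$ be an orthonormal basis of $\mathrm{span}\{|h\rangle\}_{h\in\omega}$ which is mutually unbiased to $\{|h\rangle\}_{h\in\omega}$, i.e. $|\langle h|\xi^\omega_j\rangle|^2=1/|\omega|$. (1) Alice measures $\{M_\omega\}_\omega\cup\{I-\sum_\omega M_\omega\}$, the outcome $\omega$ transforming her state by $\sqrt{M_\omega}$. (2) After the outcome $\omega$, Bob measures $\{|\xi^\omega_j\rangle\langle\xi^\omega_j|\}_j\cup\{I-\sum_j|\xi^\omega_j\rangle\langle\xi^\omega_j|\}$. (3) After the outcomes $\omega,j$, Alice measures $\{O^{\omega j},I-O^{\omega j}\}$ with $$O^{\omega j}=\frac{\sqrt{M_\omega\sigma_A}\,(|\xi^\omega_j\rangle\langle\xi^\omega_j|)^T\sqrt{M_\omega\sigma_A}}{\langle\xi^\omega_j|M_\omega\sigma_A|\xi^\omega_j\rangle},$$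 where $T$ is the transposition in the basis $|\vec x\rangle$ (and $O^{\omega j}=0$ if the denominator is $0$). The verdict is $\Psi^{\otimes n}$ on the outcome $O^{\omega j}$, and $\rho_{mix}^{\otimes n}$ in all other cases. The operator of the verdict $\Psi^{\otimes n}$ is $$T[\{m_\omega\}]=\sum_{\omega}\sum_{j}\bigl(\sqrt{M_\omega}\,O^{\omega j}\sqrt{M_\omega}\bigr)\otimes|\xi^\omega_j\rangle\langle\xi^\omega_j| .$$ The type-1 error is $\alpha(T)=\langle\Psi^{\otimes n}|(I-T)|\Psi^{\otimes n}\rangle$ and the type-2 error is $\beta(T)=\mathrm{Tr}\,T\rho_{mix}^{\otimes n}$. **Theorem.** Mutually unbiased bases as above exist for every $n$, and the following holds. (i) For every real $r<-\frac14H'_{1/2}(\Psi)$ and every $n$ there is a collection $\{m_\omega\}_\omega$ as above such that, for every choice of the mutually unbiased bases, $$\beta(T[\{m_\omega\}])\le 4|\mathcal T_n|^3(d_Ad_B)^{-n}\exp\Bigl(-n\sup_{0\le s<1}\Bigl[\frac{-2s}{1-s}r-H_{\frac{1+s}{2}}(\Psi)\Bigr]\Bigr),\qquad \alpha(T[\{m_\omega\}])\le|\mathcal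 T_n|e^{-nr}.$$ (The supremum is $+\infty$ for $r<0$; then, for $n\ge1$, the first bound is $0$.) (ii) For every $n$ there is a collection $\{m_\omega\}_\omega$ as above such that, for every choice of the mutually unbiased bases, $$\beta(T[\{m_\omega\}])\le 4|\mathcal T_n|^3(d_Ad_B)^{-n}e^{nH_{1/2}(\Psi)},\qquad \alpha(T[\{m_\omega\}])=0 .$$ -/

import Mathlib

open scoped Kronecker MatrixOrder ComplexOrder

namespace LocalTest

noncomputable section

open Matrix

/-- The rank-one operator `|v⟩⟨v|`. -/
def proj {ι : Type*} (v : ι → ℂ) : Matrix ι ι ℂ :=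
  vecMulVec v (star v)

/-- The family of vectors `e x` in `ℂ^ι` is orthonormal. -/
def IsOrthonormal {X ι : Type*} [DecidableEq X] [Fintype ι] (e : X → ι → ℂ) : Prop :=
  ∀ x y, star (e x) ⬝ᵥ e y = if x = y then 1 else 0

/-- The vector `∑ x, √(lam x) |x⟩ ⊗ |x⟩` of `ℂ^A ⊗ ℂ^B = ℂ^(A × B)`, where `|x⟩` is `eA x` on the
first factor and `eB x` on the second. -/
def schmidtVector {X A B : Type*} [Fintype X] (eA : X → A → ℂ) (eB : X → B → ℂ) (lam : X → ℝ) :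
    A × B → ℂ :=
  fun p => ∑ x, (Real.sqrt (lam x) : ℂ) * (eA x p.1 * eB x p.2)

/-- The Rényi entropy `H_α` of the distribution `lam`, which for `α = 1` is the Shannon entropy. -/
def renyi {X : Type*} [Fintype X] (lam : X → ℝ) (α : ℝ) : ℝ :=
  if α = 1 then ∑ x, Real.negMulLog (lam x)
  else Real.log (∑ x with lam x ≠ 0, lam x ^ α) / (1 - α)

/-- `sup_{0 ≤ s < 1} (-2 s r / (1 - s) - H_{(1+s)/2})`, which is `+∞` for `r < 0`. -/
def hoeffdingExponent {X : Type*} [Fintype X] (lam : X → ℝ) (r : ℝ) : EReal :=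
  ⨆ s : Set.Ico (0 : ℝ) 1,
    ((-2 * (s : ℝ) / (1 - s) * r - renyi lam ((1 + s) / 2) : ℝ) : EReal)

/-- The empirical distribution of the data `x`. -/
def empirical {X : Type*} [DecidableEq X] {n : ℕ} (x : Fin n → X) : X → ℝ :=
  fun y => ((Finset.univ.filter fun i => x i = y).card : ℝ) / n

/-- The number of types, i.e. of empirical distributions on `X` with `n` trials. -/
def numTypes (X : Type*) [DecidableEq X] (n : ℕ) : ℕ :=
  (Set.range (empirical : (Fin n → X) → X → ℝ)).ncard

/-! ### Tensor powers, with `(ℂ^A)^{⊗n} = ℂ^(Fin n → A)` -/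

/-- The product vectors `|x₁⟩ ⊗ ⋯ ⊗ |xₙ⟩`. -/
def ketPow {X A : Type*} (n : ℕ) (e : X → A → ℂ) : (Fin n → X) → (Fin n → A) → ℂ :=
  fun x u => ∏ k, e (x k) (u k)

/-- `Ψ^{⊗n}` as a vector of `(ℂ^A)^{⊗n} ⊗ (ℂ^B)^{⊗n}`. -/
def statePow {A B : Type*} (n : ℕ) (Ψ : A × B → ℂ) : (Fin n → A) × (Fin n → B) → ℂ :=
  fun p => ∏ k, Ψ (p.1 k, p.2 k)

/-- `ρ^{⊗n}` as an operator on `(ℂ^A)^{⊗n} ⊗ (ℂ^B)^{⊗n}`. -/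
def densityPow {A B : Type*} (n : ℕ) (ρ : Matrix (A × B) (A × B) ℂ) :
    Matrix ((Fin n → A) × (Fin n → B)) ((Fin n → A) × (Fin n → B)) ℂ :=
  of fun p q => ∏ k, ρ (p.1 k, p.2 k) (q.1 k, q.2 k)

/-- The completely mixed state on `ℂ^A ⊗ ℂ^B`. -/
def rhoMix (A B : Type*) [Fintype A] [Fintype B] [DecidableEq A] [DecidableEq B] :
    Matrix (A × B) (A × B) ℂ :=
  ((Fintype.card A : ℂ) * (Fintype.card B : ℂ))⁻¹ • (1 : Matrix (A × B) (A × B) ℂ)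

/-! ### The three-step protocol -/

/-- A collection `(m ω)` of non-negative measures on `X`, indexed by the subsets `ω` of `X`, with
`∑ ω, m ω x ≤ 1`. Each measure that is used has its index `ω` as its support; the others are zero. -/
structure IsMeasureCollection {X : Type*} [Fintype X] [DecidableEq X]
    (m : Finset X → X → ℝ) : Prop where
  nonneg : ∀ ω x, 0 ≤ m ω x
  sum_le_one : ∀ x, ∑ ω, m ω x ≤ 1
  support_eq : ∀ ω, m ω = 0 ∨ ∀ x, m ω x ≠ 0 ↔ x ∈ ω

/-- `ξ` (given by its coefficients in the basis `|x⟩`) is an orthonormal basis of the span of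
`|h⟩`, `h ∈ ω`, that is mutually unbiased to the basis `|h⟩`, `h ∈ ω`. -/
structure IsUnbiasedBasis {X : Type*} [Fintype X] [DecidableEq X] (ω : Finset X)
    (ξ : Fin ω.card → X → ℂ) : Prop where
  orthonormal : IsOrthonormal ξ
  span_eq : Submodule.span ℂ (Set.range ξ) =
    Submodule.span ℂ ((fun h : X => (Pi.single h 1 : X → ℂ)) '' (ω : Set X))
  unbiased : ∀ j, ∀ h ∈ ω, ‖ξ j h‖ ^ 2 = 1 / (ω.card : ℝ)

section Protocol

variable {X A B : Type*} [Fintype X] [DecidableEq X] [Fintype A] [DecidableEq A] [Fintype B]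
  [DecidableEq B]

/-- The vector `∑ x, c x |x⟩`. -/
def combine (e : X → A → ℂ) (c : X → ℂ) : A → ℂ :=
  ∑ x, c x • e x

/-- The operator `∑ x, μ x |x⟩⟨x|` of Alice's first measurement. -/
def aliceFirst (eA : X → A → ℂ) (μ : X → ℝ) : Matrix A A ℂ :=
  ∑ x, (μ x : ℂ) • proj (eA x)

/-- The partial trace over `B` of `|Ψ⟩⟨Ψ|`. -/
def reducedA (Ψ : A × B → ℂ) : Matrix A A ℂ :=
  of fun u u' => ∑ v, Ψ (u, v) * star (Ψ (u', v))

/-- Bob's measurement operator `|ξ⟩⟨ξ|`. -/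
def bobSecond (eB : X → B → ℂ) (ξ : X → ℂ) : Matrix B B ℂ :=
  proj (combine eB ξ)

/-- Alice's last measurement operator
`√(M σ_A) (|ξ⟩⟨ξ|)ᵀ √(M σ_A) / ⟨ξ| M σ_A |ξ⟩` with `M = ∑ x, μ x |x⟩⟨x|` and `σ_A` the reduced state
of `Ψ`. The transposition is in the basis `|x⟩`, so it conjugates the coefficients of `ξ`. -/
def aliceThird (eA : X → A → ℂ) (Ψ : A × B → ℂ) (μ : X → ℝ) (ξ : X → ℂ) : Matrix A A ℂ :=
  (star (combine eA ξ) ⬝ᵥ ((aliceFirst eA μ * reducedA Ψ) *ᵥ combine eA ξ))⁻¹ •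
    (CFC.sqrt (aliceFirst eA μ * reducedA Ψ) * proj (combine eA (star ξ)) *
      CFC.sqrt (aliceFirst eA μ * reducedA Ψ))

/-- The operator `T[{m ω}]` of the verdict "the state is `Ψ`" in the three-step protocol.
Alice measures with the POVM `M ω = ∑ x, m ω x |x⟩⟨x|` (and `1 - ∑ ω, M ω`, on which they stop with
the verdict "mixed"), which acts by `√(M ω)`; on the outcome `ω` Bob measures with `|ξ ω j⟩⟨ξ ω j|`
(and `1 - ∑ j, |ξ ω j⟩⟨ξ ω j|`, on which they stop with the verdict "mixed"); finally Alice measures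
with `{O, 1 - O}`, `O = aliceThird eA Ψ (m ω) (ξ ω j)`, and the verdict is "`Ψ`" on the outcome
`O`. -/
def protocolTest (eA : X → A → ℂ) (eB : X → B → ℂ) (Ψ : A × B → ℂ) (m : Finset X → X → ℝ)
    (ξ : (ω : Finset X) → Fin ω.card → X → ℂ) : Matrix (A × B) (A × B) ℂ :=
  ∑ ω, ∑ j, (CFC.sqrt (aliceFirst eA (m ω)) * aliceThird eA Ψ (m ω) (ξ ω j) *
    CFC.sqrt (aliceFirst eA (m ω))) ⊗ₖ bobSecond eB (ξ ω j)

end Protocol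

/-- The type-1 error `⟨Ψ| (1 - T) |Ψ⟩`. -/
def typeOneError {ι : Type*} [Fintype ι] [DecidableEq ι] (Ψ : ι → ℂ) (T : Matrix ι ι ℂ) : ℝ :=
  (star Ψ ⬝ᵥ ((1 - T) *ᵥ Ψ)).re

/-- The type-2 error `Tr T ρ`. -/
def typeTwoError {ι : Type*} [Fintype ι] (ρ : Matrix ι ι ℂ) (T : Matrix ι ι ℂ) : ℝ :=
  (T * ρ).trace.re

end

end LocalTest

open scoped Kronecker MatrixOrder ComplexOrder

namespace LocalTest

noncomputable section

open Matrix

set_option linter.unusedSectionVars false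

section Operators

variable {X A B : Type*} [Fintype X] [DecidableEq X] [Fintype A] [DecidableEq A] [Fintype B]
  [DecidableEq B]

lemma mul_proj_mul {ι : Type*} [Fintype ι] (S : Matrix ι ι ℂ) (hS : S.IsHermitian) (v : ι → ℂ) :
    S * proj v * S = proj (S *ᵥ v) := by
  rw [proj, mul_vecMulVec, vecMulVec_mul, proj, star_mulVec, hS.eq]

lemma trace_proj {ι : Type*} [Fintype ι] (v : ι → ℂ) : (proj v).trace = star v ⬝ᵥ v := by
  rw [proj, trace_vecMulVec, dotProduct_comm]

lemma dotProduct_proj_mulVec {ι : Type*} [Fintype ι] (v w : ι → ℂ) :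
    star w ⬝ᵥ (proj v *ᵥ w) = star (star v ⬝ᵥ w) * (star v ⬝ᵥ w) := by
  rw [proj, vecMulVec_mulVec, op_smul_eq_smul, dotProduct_smul, smul_eq_mul, mul_comm,
    star_dotProduct w v]

lemma proj_kronecker_proj {ι κ : Type*} (u : ι → ℂ) (w : κ → ℂ) :
    proj u ⊗ₖ proj w = proj fun q : ι × κ => u q.1 * w q.2 := by
  ext p q
  simp only [proj, kroneckerMap_apply, vecMulVec_apply, Pi.star_apply, star_mul']
  ring

lemma dotProduct_combine {e : X → A → ℂ} (he : IsOrthonormal e) (c d : X → ℂ) :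
    star (combine e c) ⬝ᵥ combine e d = ∑ x, star (c x) * d x := by
  simp only [combine, star_sum, star_smul, sum_dotProduct, dotProduct_sum, smul_dotProduct,
    dotProduct_smul, he _ _, smul_eq_mul, mul_ite, mul_one, mul_zero, Finset.sum_ite_eq',
    Finset.mem_univ, if_true]
  exact Finset.sum_congr rfl fun x _ => mul_comm _ _

lemma star_basis_dotProduct_combine {e : X → A → ℂ} (he : IsOrthonormal e) (x : X) (d : X → ℂ) :
    star (e x) ⬝ᵥ combine e d = d x := by
  simp only [combine, dotProduct_sum, dotProduct_smul, he _ _, smul_eq_mul, mul_ite, mul_one,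
    mul_zero, Finset.sum_ite_eq, Finset.mem_univ, if_true]

lemma aliceFirst_mulVec_combine {e : X → A → ℂ} (he : IsOrthonormal e) (μ : X → ℝ) (c : X → ℂ) :
    aliceFirst e μ *ᵥ combine e c = combine e fun x => μ x * c x := by
  simp only [aliceFirst, sum_mulVec, smul_mulVec, proj, vecMulVec_mulVec,
    star_basis_dotProduct_combine he, op_smul_eq_smul, smul_smul]
  rfl

lemma aliceFirst_mul {e : X → A → ℂ} (he : IsOrthonormal e) (μ ν : X → ℝ) :
    aliceFirst e μ * aliceFirst e ν = aliceFirst e fun x => μ x * ν x := by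
  simp only [aliceFirst, Finset.sum_mul_sum, Matrix.smul_mul, Matrix.mul_smul, proj,
    vecMulVec_mul_vecMulVec, he _ _]
  refine Finset.sum_congr rfl fun x _ => ?_
  rw [Finset.sum_eq_single x]
  · rw [if_pos rfl, one_smul, smul_smul, Complex.ofReal_mul, mul_comm]
  · intro y _ hy
    simp [hy.symm]
  · simp

lemma aliceFirst_posSemidef (e : X → A → ℂ) {μ : X → ℝ} (hμ : ∀ x, 0 ≤ μ x) :
    (aliceFirst e μ).PosSemidef := by
  refine posSemidef_sum _ fun x _ => ?_
  exact (posSemidef_vecMulVec_self_star (e x)).smul (by exact_mod_cast hμ x)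

lemma sqrt_aliceFirst {e : X → A → ℂ} (he : IsOrthonormal e) {μ : X → ℝ} (hμ : ∀ x, 0 ≤ μ x) :
    CFC.sqrt (aliceFirst e μ) = aliceFirst e fun x => Real.sqrt (μ x) := by
  refine CFC.sqrt_unique ?_ ?_
  · rw [aliceFirst_mul he]
    simp only [Real.mul_self_sqrt (hμ _)]
  · exact (aliceFirst_posSemidef e fun x => Real.sqrt_nonneg _).nonneg

lemma schmidtVector_eq_sum (eA : X → A → ℂ) (eB : X → B → ℂ) (p : X → ℝ) :
    schmidtVector eA eB p = ∑ x, (Real.sqrt (p x) : ℂ) • fun q : A × B => eA x q.1 * eB x q.2 := by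
  ext q
  simp [schmidtVector, Finset.sum_apply]

lemma star_tensor_dotProduct (u u' : A → ℂ) (w w' : B → ℂ) :
    (star fun q : A × B => u q.1 * w q.2) ⬝ᵥ (fun q => u' q.1 * w' q.2) =
      (star u ⬝ᵥ u') * (star w ⬝ᵥ w') := by
  simp only [dotProduct, Fintype.sum_prod_type, Finset.sum_mul_sum, Pi.star_apply, star_mul']
  exact Finset.sum_congr rfl fun _ _ => Finset.sum_congr rfl fun _ _ => by ring

lemma star_combine_dotProduct_basis {e : X → A → ℂ} (he : IsOrthonormal e) (x : X) (d : X → ℂ) :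
    star (combine e d) ⬝ᵥ e x = star (d x) := by
  rw [← star_basis_dotProduct_combine he x d, ← star_dotProduct]

lemma star_tensor_combine_dotProduct_schmidtVector {eA : X → A → ℂ} {eB : X → B → ℂ}
    (heA : IsOrthonormal eA) (heB : IsOrthonormal eB) (p : X → ℝ) (c d : X → ℂ) :
    (star fun q : A × B => combine eA c q.1 * combine eB d q.2) ⬝ᵥ schmidtVector eA eB p =
      ∑ x, (Real.sqrt (p x) : ℂ) * (star (c x) * star (d x)) := by
  simp only [schmidtVector_eq_sum, dotProduct_sum, dotProduct_smul, star_tensor_dotProduct,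
    star_combine_dotProduct_basis heA, star_combine_dotProduct_basis heB, smul_eq_mul]

lemma schmidtVector_norm {eA : X → A → ℂ} {eB : X → B → ℂ}
    (heA : IsOrthonormal eA) (heB : IsOrthonormal eB) {p : X → ℝ} (hp : ∀ x, 0 ≤ p x) :
    star (schmidtVector eA eB p) ⬝ᵥ schmidtVector eA eB p = ((∑ x, p x : ℝ) : ℂ) := by
  conv_lhs => rw [schmidtVector_eq_sum]
  simp only [star_sum, star_smul, sum_dotProduct, dotProduct_sum, smul_dotProduct,
    dotProduct_smul, star_tensor_dotProduct, heA _ _, heB _ _, smul_eq_mul]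
  push_cast
  refine Finset.sum_congr rfl fun x _ => ?_
  rw [Finset.sum_eq_single x]
  · simp only [if_true, mul_one, RCLike.star_def, Complex.conj_ofReal]
    exact_mod_cast Real.mul_self_sqrt (hp x)
  · intro y _ hy
    simp [hy]
  · simp

lemma reducedA_schmidtVector (eA : X → A → ℂ) {eB : X → B → ℂ}
    (heB : IsOrthonormal eB) {p : X → ℝ} (hp : ∀ x, 0 ≤ p x) :
    reducedA (schmidtVector eA eB p) = aliceFirst eA p := by
  ext u u'
  have key : ∀ x y, ∑ v, eB x v * star (eB y v) = if y = x then 1 else 0 := fun x y => by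
    rw [← heB y x, dotProduct]
    exact Finset.sum_congr rfl fun _ _ => mul_comm _ _
  calc reducedA (schmidtVector eA eB p) u u'
      = ∑ v, ∑ x, ∑ y, (Real.sqrt (p x) * Real.sqrt (p y) * (eA x u * star (eA y u'))) *
          (eB x v * star (eB y v)) := by
        simp only [reducedA, schmidtVector, of_apply, star_sum, Finset.sum_mul_sum]
        refine Finset.sum_congr rfl fun v _ => Finset.sum_congr rfl fun x _ =>
          Finset.sum_congr rfl fun y _ => ?_
        simp only [star_mul', RCLike.star_def, Complex.conj_ofReal]
        ring
    _ = ∑ x, ∑ y, (Real.sqrt (p x) * Real.sqrt (p y) * (eA x u * star (eA y u'))) *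
          ∑ v, (eB x v * star (eB y v)) := by
        rw [Finset.sum_comm]
        refine Finset.sum_congr rfl fun x _ => ?_
        rw [Finset.sum_comm]
        simp only [Finset.mul_sum]
    _ = aliceFirst eA p u u' := by
        simp only [key, mul_ite, mul_one, mul_zero, Finset.sum_ite_eq', Finset.mem_univ, if_true,
          aliceFirst, Matrix.sum_apply, Matrix.smul_apply, proj, vecMulVec_apply, Pi.star_apply,
          smul_eq_mul]
        refine Finset.sum_congr rfl fun x _ => ?_
        congr 1
        exact_mod_cast Real.mul_self_sqrt (hp x)

/-- One summand of the test, as a multiple of a rank-one product operator. -/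
lemma protocol_summand {eA : X → A → ℂ} {eB : X → B → ℂ}
    (heA : IsOrthonormal eA) (heB : IsOrthonormal eB) {p μ : X → ℝ} (hp : ∀ x, 0 ≤ p x)
    (hμ : ∀ x, 0 ≤ μ x) (ξ : X → ℂ) :
    (CFC.sqrt (aliceFirst eA μ) * aliceThird eA (schmidtVector eA eB p) μ ξ *
      CFC.sqrt (aliceFirst eA μ)) ⊗ₖ bobSecond eB ξ =
    ((∑ x, μ x * p x * ‖ξ x‖ ^ 2 : ℝ) : ℂ)⁻¹ •
      proj fun q : A × B =>
        combine eA (fun x => ((μ x * Real.sqrt (p x) : ℝ) : ℂ) * star (ξ x)) q.1 *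
          combine eB ξ q.2 := by
  have hherm : ∀ ν : X → ℝ, (∀ x, 0 ≤ ν x) → (aliceFirst eA ν).IsHermitian := fun ν hν =>
    (aliceFirst_posSemidef eA hν).isHermitian
  have hs : ∀ ν : X → ℝ, ∀ x, 0 ≤ Real.sqrt (ν x) := fun ν x => Real.sqrt_nonneg _
  rw [aliceThird, reducedA_schmidtVector eA heB hp, aliceFirst_mul heA,
    sqrt_aliceFirst heA hμ, sqrt_aliceFirst heA fun x => mul_nonneg (hμ x) (hp x),
    mul_proj_mul _ (hherm _ (hs _)), aliceFirst_mulVec_combine heA, aliceFirst_mulVec_combine heA,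
    dotProduct_combine heA, Matrix.mul_smul, Matrix.smul_mul, mul_proj_mul _ (hherm _ (hs _)),
    aliceFirst_mulVec_combine heA, smul_kronecker, bobSecond, proj_kronecker_proj]
  congr 1
  · congr 1
    push_cast
    refine Finset.sum_congr rfl fun x _ => ?_
    rw [← Complex.conj_mul']
    simp only [RCLike.star_def]
    ring
  · congr 1
    ext q
    congr 2
    ext x
    rw [← mul_assoc, ← Complex.ofReal_mul, ← Real.sqrt_mul (hμ x), ← mul_assoc,
      Real.sqrt_mul (mul_self_nonneg _), Real.sqrt_mul_self (hμ x)]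
    rfl

lemma IsUnbiasedBasis.apply_eq_zero {ω : Finset X} {ξ : Fin ω.card → X → ℂ}
    (h : IsUnbiasedBasis ω ξ) (j : Fin ω.card) {x : X} (hx : x ∉ ω) : ξ j x = 0 := by
  have hj : ξ j ∈ Submodule.span ℂ ((fun h : X => (Pi.single h 1 : X → ℂ)) '' (ω : Set X)) :=
    h.span_eq ▸ Submodule.subset_span (Set.mem_range_self j)
  have hle : Submodule.span ℂ ((fun h : X => (Pi.single h 1 : X → ℂ)) '' (ω : Set X)) ≤
      LinearMap.ker (LinearMap.proj x : (X → ℂ) →ₗ[ℂ] ℂ) := by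
    rw [Submodule.span_le]
    rintro _ ⟨y, hy, rfl⟩
    have : x ≠ y := fun hxy => hx (hxy ▸ hy)
    simp [this]
  exact hle hj

/-- A measure supported in `ω` sees each vector of an unbiased basis as the uniform weight. -/
lemma IsUnbiasedBasis.sum_mul_norm_sq {ω : Finset X} {ξ : Fin ω.card → X → ℂ}
    (h : IsUnbiasedBasis ω ξ) (j : Fin ω.card) {g : X → ℝ} (hg : ∀ x ∉ ω, g x = 0) :
    ∑ x, g x * ‖ξ j x‖ ^ 2 = (∑ x, g x) / ω.card := by
  rw [Finset.sum_div]
  refine Finset.sum_congr rfl fun x _ => ?_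
  by_cases hx : x ∈ ω
  · rw [h.unbiased j x hx]; ring
  · simp [hg x hx]

lemma IsUnbiasedBasis.sum_norm_sq {ω : Finset X} {ξ : Fin ω.card → X → ℂ}
    (h : IsUnbiasedBasis ω ξ) (j : Fin ω.card) : ∑ x, ‖ξ j x‖ ^ 2 = 1 := by
  have := h.orthonormal j j
  rw [if_pos rfl, dotProduct] at this
  have h2 : ((∑ x, ‖ξ j x‖ ^ 2 : ℝ) : ℂ) = 1 := by
    rw [← this]
    push_cast
    exact Finset.sum_congr rfl fun x _ => (Complex.conj_mul' _).symm
  exact_mod_cast h2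

/-- The contribution of a measure `μ` with index set `ω` to the trace of the test. -/
def traceCost (p : X → ℝ) (ω : Finset X) (μ : X → ℝ) : ℝ :=
  ω.card * ((∑ x, μ x ^ 2 * p x) / ∑ x, μ x * p x)

lemma IsMeasureCollection.apply_eq_zero {m : Finset X → X → ℝ} (hm : IsMeasureCollection m)
    {ω : Finset X} {x : X} (hx : x ∉ ω) : m ω x = 0 := by
  rcases hm.support_eq ω with h | h
  · simp [h]
  · by_contra hne
    exact hx ((h x).1 hne)

theorem trace_protocolTest {eA : X → A → ℂ} {eB : X → B → ℂ}
    (heA : IsOrthonormal eA) (heB : IsOrthonormal eB) {p : X → ℝ} (hp : ∀ x, 0 ≤ p x)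
    {m : Finset X → X → ℝ} (hm : IsMeasureCollection m)
    {ξ : (ω : Finset X) → Fin ω.card → X → ℂ} (hξ : ∀ ω, IsUnbiasedBasis ω (ξ ω)) :
    (protocolTest eA eB (schmidtVector eA eB p) m ξ).trace =
      ((∑ ω, traceCost p ω (m ω) : ℝ) : ℂ) := by
  rw [protocolTest, trace_sum]
  push_cast
  refine Finset.sum_congr rfl fun ω _ => ?_
  rw [trace_sum]
  have key : ∀ j : Fin ω.card, ((CFC.sqrt (aliceFirst eA (m ω)) *
      aliceThird eA (schmidtVector eA eB p) (m ω) (ξ ω j) *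
      CFC.sqrt (aliceFirst eA (m ω))) ⊗ₖ bobSecond eB (ξ ω j)).trace =
      (((∑ x, m ω x ^ 2 * p x) / ∑ x, m ω x * p x : ℝ) : ℂ) := by
    intro j
    have hcard : (ω.card : ℝ) ≠ 0 := by
      have := j.pos
      positivity
    rw [protocol_summand heA heB hp (hm.nonneg ω), trace_smul, trace_proj, star_tensor_dotProduct,
      dotProduct_combine heA, dotProduct_combine heB]
    have e1 : ∑ x, star (((m ω x * Real.sqrt (p x) : ℝ) : ℂ) * star (ξ ω j x)) *
        (((m ω x * Real.sqrt (p x) : ℝ) : ℂ) * star (ξ ω j x)) =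
        ((∑ x, m ω x ^ 2 * p x * ‖ξ ω j x‖ ^ 2 : ℝ) : ℂ) := by
      rw [Complex.ofReal_sum]
      refine Finset.sum_congr rfl fun x _ => ?_
      have : m ω x ^ 2 * p x = (m ω x * Real.sqrt (p x)) ^ 2 := by
        rw [mul_pow, Real.sq_sqrt (hp x)]
      rw [this]
      push_cast
      rw [← Complex.conj_mul']
      simp only [RCLike.star_def, map_mul, Complex.conj_ofReal, Complex.conj_conj]
      ring
    have e2 : ∑ x, star (ξ ω j x) * ξ ω j x = ((∑ x, ‖ξ ω j x‖ ^ 2 : ℝ) : ℂ) := by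
      push_cast
      exact Finset.sum_congr rfl fun x _ => Complex.conj_mul' _
    rw [e1, e2, (hξ ω).sum_norm_sq, (hξ ω).sum_mul_norm_sq, (hξ ω).sum_mul_norm_sq,
      smul_eq_mul, ← Complex.ofReal_inv, ← Complex.ofReal_mul, ← Complex.ofReal_mul]
    · congr 1
      by_cases hP : ∑ x, m ω x * p x = 0
      · simp [hP]
      · field_simp
    · intro x hx; simp [hm.apply_eq_zero hx]
    · intro x hx; simp [hm.apply_eq_zero hx]
  simp [key, traceCost]

theorem expectation_protocolTest {eA : X → A → ℂ} {eB : X → B → ℂ}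
    (heA : IsOrthonormal eA) (heB : IsOrthonormal eB) {p : X → ℝ} (hp : ∀ x, 0 ≤ p x)
    {m : Finset X → X → ℝ} (hm : IsMeasureCollection m)
    {ξ : (ω : Finset X) → Fin ω.card → X → ℂ} (hξ : ∀ ω, IsUnbiasedBasis ω (ξ ω)) :
    star (schmidtVector eA eB p) ⬝ᵥ
      (protocolTest eA eB (schmidtVector eA eB p) m ξ *ᵥ schmidtVector eA eB p) =
      ((∑ ω, ∑ x, m ω x * p x : ℝ) : ℂ) := by
  rw [protocolTest, sum_mulVec, dotProduct_sum]
  push_cast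
  refine Finset.sum_congr rfl fun ω _ => ?_
  rw [sum_mulVec, dotProduct_sum]
  have key : ∀ j : Fin ω.card, star (schmidtVector eA eB p) ⬝ᵥ (((CFC.sqrt (aliceFirst eA (m ω)) *
      aliceThird eA (schmidtVector eA eB p) (m ω) (ξ ω j) *
      CFC.sqrt (aliceFirst eA (m ω))) ⊗ₖ bobSecond eB (ξ ω j)) *ᵥ schmidtVector eA eB p) =
      (((∑ x, m ω x * p x) / ω.card : ℝ) : ℂ) := by
    intro j
    rw [protocol_summand heA heB hp (hm.nonneg ω), smul_mulVec, dotProduct_smul,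
      dotProduct_proj_mulVec, star_tensor_combine_dotProduct_schmidtVector heA heB]
    have e1 : ∑ x, (Real.sqrt (p x) : ℂ) *
        (star (((m ω x * Real.sqrt (p x) : ℝ) : ℂ) * star (ξ ω j x)) * star (ξ ω j x)) =
        ((∑ x, m ω x * p x * ‖ξ ω j x‖ ^ 2 : ℝ) : ℂ) := by
      rw [Complex.ofReal_sum]
      refine Finset.sum_congr rfl fun x _ => ?_
      have : m ω x * p x = m ω x * (Real.sqrt (p x) * Real.sqrt (p x)) := by
        rw [Real.mul_self_sqrt (hp x)]
      rw [this]
      push_cast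
      rw [← Complex.conj_mul']
      simp only [RCLike.star_def, map_mul, Complex.conj_ofReal, Complex.conj_conj]
      ring
    rw [e1, (hξ ω).sum_mul_norm_sq, RCLike.star_def, Complex.conj_ofReal,
      smul_eq_mul, ← Complex.ofReal_inv, ← Complex.ofReal_mul, ← Complex.ofReal_mul]
    · congr 1
      by_cases hP : (∑ x, m ω x * p x) / ω.card = 0
      · simp [hP]
      · exact inv_mul_cancel_left₀ hP _
    · intro x hx; simp [hm.apply_eq_zero hx]
  simp only [key, Finset.sum_const, Finset.card_univ, Fintype.card_fin, nsmul_eq_mul]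
  by_cases hω : ω.card = 0
  · have : ∀ x, m ω x = 0 := fun x => hm.apply_eq_zero (by simp [Finset.card_eq_zero.1 hω])
    simp [hω, this]
  · have : (ω.card : ℂ) ≠ 0 := by exact_mod_cast hω
    push_cast
    field_simp

end Operators

section TensorPowers

variable {X A B : Type*} [Fintype X] [DecidableEq X] [Fintype A] [DecidableEq A] [Fintype B]
  [DecidableEq B]

lemma isOrthonormal_ketPow {e : X → A → ℂ} (he : IsOrthonormal e) (n : ℕ) :
    IsOrthonormal (ketPow n e) := by
  intro x y
  have h : star (ketPow n e x) ⬝ᵥ ketPow n e y = ∏ k, star (e (x k)) ⬝ᵥ e (y k) := by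
    simp only [dotProduct, ketPow, Pi.star_apply, star_prod, ← Finset.prod_mul_distrib]
    rw [Finset.prod_univ_sum, Fintype.piFinset_univ]
  rw [h]
  simp only [he _ _]
  split_ifs with hxy
  · simp [hxy]
  · obtain ⟨k, hk⟩ := Function.ne_iff.1 hxy
    exact Finset.prod_eq_zero (Finset.mem_univ k) (if_neg hk)

lemma statePow_schmidtVector (eA : X → A → ℂ) (eB : X → B → ℂ) {lam : X → ℝ}
    (hlam : ∀ x, 0 ≤ lam x) (n : ℕ) :
    statePow n (schmidtVector eA eB lam) =
      schmidtVector (ketPow n eA) (ketPow n eB) fun x => ∏ k, lam (x k) := by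
  ext q
  simp only [statePow, schmidtVector, ketPow]
  rw [Finset.prod_univ_sum, Fintype.piFinset_univ]
  refine Finset.sum_congr rfl fun x _ => ?_
  rw [Real.sqrt_prod _ fun k _ => hlam (x k)]
  push_cast
  rw [← Finset.prod_mul_distrib, ← Finset.prod_mul_distrib]

lemma densityPow_smul_one (c : ℂ) (n : ℕ) :
    densityPow n (c • (1 : Matrix (A × B) (A × B) ℂ)) = c ^ n • 1 := by
  ext p q
  simp only [densityPow, of_apply, Matrix.smul_apply, smul_eq_mul, Finset.prod_mul_distrib,
    Finset.prod_const, Finset.card_univ, Fintype.card_fin, Matrix.one_apply]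
  congr 1
  split_ifs with h
  · simp [h]
  · have : ∃ k, ¬((p.1 k, p.2 k) = (q.1 k, q.2 k)) := by
      by_contra hc
      push Not at hc
      exact h (Prod.ext (funext fun k => (Prod.ext_iff.1 (hc k)).1)
        (funext fun k => (Prod.ext_iff.1 (hc k)).2))
    obtain ⟨k, hk⟩ := this
    exact Finset.prod_eq_zero (Finset.mem_univ k) (if_neg hk)

end TensorPowers

section Collections

variable {Y : Type*} [Fintype Y] [DecidableEq Y] {p : Y → ℝ}

/-- The trace cost is subadditive for a fixed index set. -/
lemma traceCost_add_le (hp : ∀ x, 0 ≤ p x) (ω : Finset Y) {μ ν : Y → ℝ} (hμ : ∀ x, 0 ≤ μ x)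
    (hν : ∀ x, 0 ≤ ν x) : traceCost p ω (μ + ν) ≤ traceCost p ω μ + traceCost p ω ν := by
  have hzero : ∀ μ : Y → ℝ, (∀ x, 0 ≤ μ x) → ∑ x, μ x * p x = 0 → ∀ x, μ x * p x = 0 :=
    fun μ hμ h x => (Finset.sum_eq_zero_iff_of_nonneg
      (fun x _ => mul_nonneg (hμ x) (hp x))).1 h x (Finset.mem_univ x)
  simp only [traceCost, ← mul_add, Pi.add_apply, add_mul, Finset.sum_add_distrib]
  refine mul_le_mul_of_nonneg_left ?_ (Nat.cast_nonneg _)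
  rcases (Finset.sum_nonneg fun x (_ : x ∈ Finset.univ) =>
    mul_nonneg (hμ x) (hp x)).eq_or_lt with ha | ha
  · have h0 := hzero μ hμ ha.symm
    have : ∀ x, (μ x + ν x) ^ 2 * p x = ν x ^ 2 * p x := fun x => by
      linear_combination (μ x + 2 * ν x) * h0 x
    simp [← ha, this]
  rcases (Finset.sum_nonneg fun x (_ : x ∈ Finset.univ) =>
    mul_nonneg (hν x) (hp x)).eq_or_lt with hb | hb
  · have h0 := hzero ν hν hb.symm
    have : ∀ x, (μ x + ν x) ^ 2 * p x = μ x ^ 2 * p x := fun x => by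
      linear_combination (ν x + 2 * μ x) * h0 x
    simp [← hb, this]
  · generalize ∑ x, μ x * p x = a at *
    generalize ∑ x, ν x * p x = b at *
    rw [Finset.sum_div, Finset.sum_div, Finset.sum_div, ← Finset.sum_add_distrib]
    refine Finset.sum_le_sum fun x _ => ?_
    rw [div_add_div _ _ ha.ne' hb.ne', div_le_div_iff₀ (by positivity) (by positivity)]
    nlinarith [mul_nonneg (hp x) (sq_nonneg (μ x * b - ν x * a))]

/-- Some collection of measures indexed by their supports has total mass function `g` and trace
cost at most `c`. -/
def Achievable (p : Y → ℝ) (g : Y → ℝ) (c : ℝ) : Prop :=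
  ∃ m : Finset Y → Y → ℝ, (∀ ω x, 0 ≤ m ω x) ∧ (∀ ω, m ω = 0 ∨ ∀ x, m ω x ≠ 0 ↔ x ∈ ω) ∧
    (∀ x, ∑ ω, m ω x = g x) ∧ ∑ ω, traceCost p ω (m ω) ≤ c

lemma Achievable.mono {g : Y → ℝ} {c c' : ℝ} (h : Achievable p g c) (hc : c ≤ c') :
    Achievable p g c' := by
  obtain ⟨m, h1, h2, h3, h4⟩ := h
  exact ⟨m, h1, h2, h3, h4.trans hc⟩

lemma Achievable.congr_mass {g g' : Y → ℝ} {c : ℝ} (h : Achievable p g c) (hg : g = g') :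
    Achievable p g' c :=
  hg ▸ h

lemma achievable_zero : Achievable p 0 0 :=
  ⟨0, fun _ _ => le_rfl, fun _ => Or.inl rfl, fun _ => by simp, by simp [traceCost]⟩

lemma Achievable.add (hp : ∀ x, 0 ≤ p x) {g g' : Y → ℝ} {c c' : ℝ} (h : Achievable p g c)
    (h' : Achievable p g' c') : Achievable p (g + g') (c + c') := by
  obtain ⟨m, h1, h2, h3, h4⟩ := h
  obtain ⟨m', h1', h2', h3', h4'⟩ := h'
  refine ⟨m + m', fun ω x => add_nonneg (h1 ω x) (h1' ω x), fun ω => ?_, fun x => ?_, ?_⟩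
  · rcases h2 ω with h | h
    · rcases h2' ω with h' | h'
      · left; simp [h, h']
      · right; simpa [h] using h'
    · rcases h2' ω with h' | h'
      · right; simpa [h'] using h
      · right
        intro x
        rw [← h x]
        have := h1 ω x
        have := h1' ω x
        simp only [Pi.add_apply]
        constructor
        · intro hne h0
          have : m' ω x = 0 := by
            by_contra h5
            exact (h x).2 ((h' x).1 h5) h0
          exact hne (by rw [h0, this, add_zero])
        · intro hne h0
          exact hne (by linarith)
  · simp [Finset.sum_add_distrib, h3, h3']
  · refine le_trans ?_ (add_le_add h4 h4')
    rw [← Finset.sum_add_distrib]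
    exact Finset.sum_le_sum fun ω _ => traceCost_add_le hp ω (h1 ω) (h1' ω)

lemma Achievable.sum (hp : ∀ x, 0 ≤ p x) {ι : Type*} (s : Finset ι) {g : ι → Y → ℝ} {c : ι → ℝ}
    (h : ∀ i ∈ s, Achievable p (g i) (c i)) : Achievable p (∑ i ∈ s, g i) (∑ i ∈ s, c i) := by
  classical
  induction s using Finset.induction_on with
  | empty => simpa using achievable_zero
  | insert i s hi ih =>
    rw [Finset.sum_insert hi, Finset.sum_insert hi]
    exact (h i (Finset.mem_insert_self i s)).add hp
      (ih fun k hk => h k (Finset.mem_insert_of_mem hk))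

lemma achievable_single {ω : Finset Y} {μ : Y → ℝ} (hμ : ∀ x, 0 ≤ μ x)
    (hω : ∀ x, μ x ≠ 0 ↔ x ∈ ω) : Achievable p μ (traceCost p ω μ) := by
  refine ⟨fun ω' => if ω' = ω then μ else 0, fun ω' x => ?_, fun ω' => ?_, fun x => ?_, ?_⟩
  · beta_reduce
    split_ifs
    exacts [hμ x, le_rfl]
  · beta_reduce
    split_ifs with h
    · right; rwa [h]
    · left; rfl
  · simp [ite_apply]
  · rw [Finset.sum_eq_single ω]
    · simp
    · intro ω' _ h
      simp [h, traceCost]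
    · simp

lemma achievable_const (C : Finset Y) {t : ℝ} (ht : 0 ≤ t) :
    Achievable p (fun x => if x ∈ C then t else 0) (C.card * t) := by
  rcases ht.eq_or_lt with rfl | ht
  · convert achievable_zero (p := p) using 1
    · ext; simp
    · simp
  · refine (achievable_single (ω := C) (fun x => ?_) fun x => ?_).mono ?_
    · split_ifs
      exacts [ht.le, le_rfl]
    · simp [ht.ne']
    · have h1 : ∑ x, (if x ∈ C then t else 0) ^ 2 * p x = t * (t * ∑ x ∈ C, p x) := by
        simp [ite_pow, ite_mul, Finset.sum_ite_mem, Finset.mul_sum, sq, mul_assoc]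
      have h2 : ∑ x, (if x ∈ C then t else 0) * p x = t * ∑ x ∈ C, p x := by
        simp [ite_mul, Finset.sum_ite_mem, Finset.mul_sum]
      rw [traceCost, h1, h2]
      refine mul_le_mul_of_nonneg_left ?_ (Nat.cast_nonneg _)
      by_cases h : t * ∑ x ∈ C, p x = 0
      · simp [h, ht.le]
      · rw [mul_div_cancel_right₀ _ h]

lemma traceCost_two_level {S D : Finset Y} (hSD : Disjoint S D) {a b t c : ℝ}
    (hS : ∀ x ∈ S, p x = a) (hD : ∀ x ∈ D, p x = b) (hcard : S.card = D.card) (hD0 : 0 < D.card)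
    (ha : 0 ≤ a) (hb : 0 < b) (ht : 0 < t) (hc : 0 < c) :
    traceCost p (S ∪ D) (fun x => if x ∈ S then t else if x ∈ D then c * t else 0) ≤
      2 * D.card * t * (a / (c * b) + c) := by
  have hsum : ∀ F : ℝ → ℝ, F 0 = 0 →
      ∑ x, F (if x ∈ S then t else if x ∈ D then c * t else 0) * p x =
        D.card * (F t * a + F (c * t) * b) := by
    intro F hF
    have : ∀ x, F (if x ∈ S then t else if x ∈ D then c * t else 0) * p x =
        (if x ∈ S then F t * a else 0) + (if x ∈ D then F (c * t) * b else 0) := by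
      intro x
      by_cases hxS : x ∈ S
      · have hxD : x ∉ D := Finset.disjoint_left.1 hSD hxS
        simp [hxS, hxD, hS x hxS]
      · by_cases hxD : x ∈ D
        · simp [hxS, hxD, hD x hxD]
        · simp [hxS, hxD, hF]
    simp only [this, Finset.sum_add_distrib, Finset.sum_ite_mem, Finset.univ_inter,
      Finset.sum_const, hcard, nsmul_eq_mul]
    ring
  have hq : (0 : ℝ) < D.card := by exact_mod_cast hD0
  rw [traceCost, hsum (fun y => y ^ 2) (by simp), hsum (fun y => y) rfl,
    Finset.card_union_of_disjoint hSD, hcard, mul_div_mul_left _ _ hq.ne']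
  push_cast
  have h1 : (t ^ 2 * a + (c * t) ^ 2 * b) / (t * a + c * t * b) ≤ t * (a / (c * b) + c) := by
    rw [div_le_iff₀ (by positivity)]
    have e : t * (a / (c * b) + c) * (t * a + c * t * b) =
        t ^ 2 * a + (c * t) ^ 2 * b + t ^ 2 * (a ^ 2 / (c * b) + c * a) := by
      field_simp
      ring
    rw [e]
    have : 0 ≤ t ^ 2 * (a ^ 2 / (c * b) + c * a) := by positivity
    linarith
  calc ((D.card : ℝ) + D.card) * ((t ^ 2 * a + (c * t) ^ 2 * b) / (t * a + c * t * b))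
      ≤ ((D.card : ℝ) + D.card) * (t * (a / (c * b) + c)) :=
        mul_le_mul_of_nonneg_left h1 (by positivity)
    _ = _ := by ring

lemma card_filter_mem_powersetCard {C : Finset Y} {x : Y} (hx : x ∈ C) {q : ℕ} (hq : 0 < q) :
    ((C.powersetCard q).filter fun S => x ∈ S).card = (C.card - 1).choose (q - 1) := by
  have := Finset.card_filter_powersetCard_subset {x} C q (by simpa using hx) (by rwa [Finset.card_singleton])
  simpa using this

/-- A large class `C` is covered by pairing each of its subsets of size `|D|` with the class `D`. -/
lemma achievable_pair (hp : ∀ x, 0 ≤ p x) {C D : Finset Y} (hCD : Disjoint C D) {a b ε : ℝ}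
    (hC : ∀ x ∈ C, p x = a) (hD : ∀ x ∈ D, p x = b) (hcard : D.card ≤ C.card) (hD0 : 0 < D.card)
    (ha : 0 ≤ a) (hb : 0 < b) (hε : 0 < ε) :
    Achievable p (fun x => (if x ∈ C then 1 else 0) + if x ∈ D then ε else 0)
      (2 * (C.card * (C.card * a)) / (ε * (D.card * b)) + 2 * ε * D.card) := by
  have hq : (0 : ℝ) < D.card := by exact_mod_cast hD0
  have hN : (0 : ℝ) < C.card := by exact_mod_cast hD0.trans_le hcard
  set k : ℕ := (C.card - 1).choose (D.card - 1) with hk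
  have hk0 : 0 < k := Nat.choose_pos (by omega)
  have hk0' : (0 : ℝ) < k := by exact_mod_cast hk0
  have hchoose : (C.card.choose D.card : ℝ) * D.card = C.card * k := by
    have h := Nat.add_one_mul_choose_eq (C.card - 1) (D.card - 1)
    rw [Nat.sub_add_cancel hD0, Nat.sub_add_cancel (hD0.trans_le hcard)] at h
    exact_mod_cast h.symm
  set c : ℝ := ε * D.card / C.card with hc
  have hc0 : 0 < c := by positivity
  have hmem : ∀ S ∈ C.powersetCard D.card, S ⊆ C ∧ S.card = D.card := fun S hS =>
    Finset.mem_powersetCard.1 hS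
  have key := Achievable.sum hp (C.powersetCard D.card)
    (g := fun S x => if x ∈ S then (k : ℝ)⁻¹ else if x ∈ D then c * (k : ℝ)⁻¹ else 0)
    (c := fun _ => 2 * D.card * (k : ℝ)⁻¹ * (a / (c * b) + c)) (fun S hS => by
      have hSD : Disjoint S D := hCD.mono_left (hmem S hS).1
      refine (achievable_single (ω := S ∪ D) (fun x => ?_) fun x => ?_).mono
        (traceCost_two_level hSD (fun x hx => hC x ((hmem S hS).1 hx)) hD (hmem S hS).2 hD0
          ha hb (by positivity) hc0)
      · split_ifs <;> positivity
      · by_cases h1 : x ∈ S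
        · simp [h1, hk0.ne']
        · by_cases h2 : x ∈ D
          · simp [h1, h2, hk0.ne', hc0.ne']
          · simp [h1, h2])
  convert key using 1
  · ext x
    rw [Finset.sum_apply]
    by_cases hxC : x ∈ C
    · have hxD : x ∉ D := Finset.disjoint_left.1 hCD hxC
      simp only [hxC, hxD, if_true, if_false, add_zero]
      rw [← Finset.sum_filter, Finset.sum_const, card_filter_mem_powersetCard hxC hD0,
        nsmul_eq_mul, mul_inv_cancel₀ hk0'.ne']
    · have hS : ∀ S ∈ C.powersetCard D.card, (if x ∈ S then (k : ℝ)⁻¹ else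
          if x ∈ D then c * (k : ℝ)⁻¹ else 0) = if x ∈ D then c * (k : ℝ)⁻¹ else 0 :=
        fun S hS => if_neg fun h => hxC ((hmem S hS).1 h)
      rw [Finset.sum_congr rfl hS, Finset.sum_const, Finset.card_powersetCard, nsmul_eq_mul]
      by_cases hxD : x ∈ D
      · simp only [hxC, hxD, if_true, if_false, zero_add]
        rw [hc]
        field_simp
        linear_combination -hchoose
      · simp [hxC, hxD]
  · rw [Finset.sum_const, Finset.card_powersetCard, nsmul_eq_mul]
    have : (C.card.choose D.card : ℝ) * (2 * D.card * (k : ℝ)⁻¹ * (a / (c * b) + c)) =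
        (C.card.choose D.card * D.card) * (2 * (k : ℝ)⁻¹ * (a / (c * b) + c)) := by ring
    rw [this, hchoose, hc]
    field_simp

end Collections

section Types

variable {Y ι : Type*} [Fintype Y] [DecidableEq Y] [DecidableEq ι] {p : Y → ℝ}

/-- Covering all fibres of `f` of probability more than `θ`, when `p` is constant on the fibres. -/
theorem achievable_fibres (hp : ∀ x, 0 ≤ p x) (hsum : ∑ x, p x = 1) (f : Y → ι)
    (hf : ∀ x y, f x = f y → p x = p y) {θ M : ℝ} (hM : 0 ≤ M)
    (hbound : ∀ i, θ < ∑ x with f x = i, p x →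
      (Finset.univ.filter fun x => f x = i).card * (∑ x with f x = i, p x) ≤ M) :
    Achievable p (fun x => if θ < ∑ y with f y = f x, p y then 1 else 0)
      (4 * ((Finset.univ.image f).card : ℝ) ^ 3 * M) := by
  set I := Finset.univ.image f with hI
  set K : ℝ := (I.card : ℝ) with hK
  set C : ι → Finset Y := fun i => Finset.univ.filter fun x => f x = i with hC
  set w : ι → ℝ := fun i => ∑ x ∈ C i, p x with hw
  set S : Finset ι := I.filter fun i => θ < w i with hS
  have hgoal : (fun x => if θ < ∑ y with f y = f x, p y then (1 : ℝ) else 0) =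
      fun x => if f x ∈ S then 1 else 0 := by
    ext x
    have : f x ∈ I := Finset.mem_image_of_mem f (Finset.mem_univ x)
    simp [hS, this, hw, hC]
  rw [hgoal]
  rcases S.eq_empty_or_nonempty with hSe | hSne
  · rw [hSe]
    refine Achievable.mono (c := 0) ?_ (by positivity)
    exact achievable_zero.congr_mass (by ext; simp)
  obtain ⟨j, hjS, hjmax⟩ := S.exists_max_image w hSne
  have hjI : j ∈ I := (Finset.mem_filter.1 hjS).1
  have hw1 : ∑ i ∈ I, w i = 1 := by
    rw [← hsum]
    exact Finset.sum_fiberwise_of_maps_to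
      (fun x _ => Finset.mem_image_of_mem f (Finset.mem_univ x)) p
  have hK1 : 1 ≤ K := by
    have : 0 < I.card := Finset.card_pos.2 ⟨j, hjI⟩
    rw [hK]
    exact_mod_cast this
  have hK0 : 0 < K := by linarith
  have hwj : 1 ≤ K * w j := by
    rw [← hw1, hK, ← nsmul_eq_mul]
    refine Finset.sum_le_card_nsmul _ _ _ fun i hi => ?_
    by_cases hiS : i ∈ S
    · exact hjmax i hiS
    · have h1 : ¬ θ < w i := fun h => hiS (Finset.mem_filter.2 ⟨hi, h⟩)
      have h2 : θ < w j := (Finset.mem_filter.1 hjS).2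
      linarith
  have hMi : ∀ i ∈ S, (C i).card * w i ≤ M := fun i hi =>
    hbound i (Finset.mem_filter.1 hi).2
  have hCj : ((C j).card : ℝ) ≤ K * M := by
    calc ((C j).card : ℝ) ≤ (C j).card * (K * w j) :=
          le_mul_of_one_le_right (Nat.cast_nonneg _) hwj
      _ = K * ((C j).card * w j) := by ring
      _ ≤ K * M := mul_le_mul_of_nonneg_left (hMi j hjS) hK0.le
  have hKM : K * M ≤ K ^ 2 * M := by nlinarith [mul_nonneg hK0.le hM]
  have hrep : ∀ i ∈ S, ∃ a, 0 ≤ a ∧ (∀ x ∈ C i, p x = a) ∧ (C i).card * a = w i ∧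
      0 < (C i).card := by
    intro i hi
    obtain ⟨x, -, hx⟩ := Finset.mem_image.1 (Finset.mem_filter.1 hi).1
    have hconst : ∀ y ∈ C i, p y = p x := fun y hy =>
      hf y x ((Finset.mem_filter.1 hy).2.trans hx.symm)
    refine ⟨p x, hp x, hconst, ?_, Finset.card_pos.2 ⟨x, by simp [hC, hx]⟩⟩
    rw [hw]
    beta_reduce
    rw [Finset.sum_congr rfl hconst, Finset.sum_const, nsmul_eq_mul]
  obtain ⟨b, hb0, hbj, hbw, hCj0⟩ := hrep j hjS
  have hCj0' : (0 : ℝ) < (C j).card := by exact_mod_cast hCj0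
  have hwj0 : 0 < w j := by
    by_contra h
    nlinarith
  have hb : 0 < b := by
    by_contra h
    nlinarith
  have hKinv : K⁻¹ ≤ 1 := inv_le_one_of_one_le₀ hK1
  have hother : ∀ i ∈ S.erase j, Achievable p
      (fun x => (if x ∈ C i then 1 else 0) + if x ∈ C j then K⁻¹ else 0) (4 * K ^ 2 * M) := by
    intro i hi
    obtain ⟨hij, hiS⟩ := Finset.mem_erase.1 hi
    obtain ⟨a, ha0, hai, haw, -⟩ := hrep i hiS
    have hdisj : Disjoint (C i) (C j) := Finset.disjoint_left.2 fun x h1 h2 =>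
      hij ((Finset.mem_filter.1 h1).2.symm.trans (Finset.mem_filter.1 h2).2)
    rcases le_total (C i).card (C j).card with hle | hle
    · refine ((achievable_const (C i) zero_le_one).add hp
        (achievable_const (C j) (inv_nonneg.2 hK0.le))).mono ?_
      have h1 : ((C i).card : ℝ) ≤ (C j).card := by exact_mod_cast hle
      have h2 : ((C j).card : ℝ) * K⁻¹ ≤ (C j).card := mul_le_of_le_one_right hCj0'.le hKinv
      nlinarith
    · refine (achievable_pair hp hdisj hai hbj hle hCj0 ha0 hb (inv_pos.2 hK0)).mono ?_
      have h2 : ((C j).card : ℝ) * K⁻¹ ≤ (C j).card := mul_le_of_le_one_right hCj0'.le hKinv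
      have h3 : 2 * ((C i).card * ((C i).card * a)) / (K⁻¹ * ((C j).card * b)) ≤ 2 * K ^ 2 * M := by
        rw [haw, hbw, div_le_iff₀ (by positivity)]
        have h4 : 2 * K ^ 2 * M * (K⁻¹ * w j) = 2 * M * (K * w j) := by
          field_simp
        rw [h4]
        nlinarith [hMi i hiS]
      nlinarith
  have hScard : (S.card : ℝ) ≤ K := by
    rw [hK]
    exact_mod_cast Finset.card_filter_le _ _
  have hSj : ((S.erase j).card : ℝ) = S.card - 1 := by
    rw [Finset.card_erase_of_mem hjS, Nat.cast_sub (Finset.card_pos.2 ⟨j, hjS⟩), Nat.cast_one]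
  have hrest0 : 0 ≤ 1 - ((S.erase j).card : ℝ) * K⁻¹ := by
    have : ((S.erase j).card : ℝ) * K⁻¹ ≤ 1 := by
      rw [← div_eq_mul_inv, div_le_one hK0]
      linarith
    linarith
  refine (((Achievable.sum hp _ hother).add hp (achievable_const (C j) hrest0)).mono
    (c' := 4 * K ^ 3 * M) ?_).congr_mass ?_
  · rw [Finset.sum_const, nsmul_eq_mul, hSj]
    have h1 : ((C j).card : ℝ) * (1 - (S.card - 1) * K⁻¹) ≤ (C j).card := by
      refine mul_le_of_le_one_right hCj0'.le ?_
      have : (1 : ℝ) ≤ S.card := by exact_mod_cast Finset.card_pos.2 ⟨j, hjS⟩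
      have : 0 ≤ ((S.card : ℝ) - 1) * K⁻¹ := mul_nonneg (by linarith) (inv_nonneg.2 hK0.le)
      linarith
    have h2 : 0 ≤ 4 * K ^ 2 * M := by positivity
    nlinarith
  · ext x
    have hx : ∀ i, x ∈ C i ↔ f x = i := fun i => by simp [hC]
    simp only [Pi.add_apply, Finset.sum_apply, Finset.sum_add_distrib, hx, Finset.sum_const,
      nsmul_eq_mul, Finset.sum_ite_eq, Finset.mem_erase]
    by_cases h : f x = j
    · simp [h, hjS]
    · simp [h]

end Types

section UnbiasedBases

variable {Y : Type*} [Fintype Y] [DecidableEq Y]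

lemma IsOrthonormal.linearIndependent {ι : Type*} [Fintype ι] [DecidableEq ι] {e : ι → Y → ℂ}
    (he : IsOrthonormal e) : LinearIndependent ℂ e := by
  rw [Fintype.linearIndependent_iff]
  intro g hg i
  rw [← star_basis_dotProduct_combine he i g, combine, hg, dotProduct_zero]

lemma isUnbiasedBasis_of_orthonormal {ω : Finset Y} {ξ : Fin ω.card → Y → ℂ}
    (ho : IsOrthonormal ξ) (hz : ∀ j, ∀ x ∉ ω, ξ j x = 0)
    (hu : ∀ j, ∀ h ∈ ω, ‖ξ j h‖ ^ 2 = 1 / (ω.card : ℝ)) : IsUnbiasedBasis ω ξ := by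
  refine ⟨ho, Submodule.eq_of_le_of_finrank_le ?_ ?_, hu⟩
  · rw [Submodule.span_le]
    rintro _ ⟨j, rfl⟩
    have hj : ξ j = ∑ x ∈ ω, ξ j x • (Pi.single x 1 : Y → ℂ) := by
      ext y
      rw [Finset.sum_apply]
      by_cases hy : y ∈ ω
      · simp [Pi.single_apply, hy]
      · simp [Pi.single_apply, hy, hz j y hy]
    rw [hj]
    exact Submodule.sum_mem _ fun x hx =>
      Submodule.smul_mem _ _ (Submodule.subset_span ⟨x, hx, rfl⟩)
  · rw [finrank_span_eq_card ho.linearIndependent, Fintype.card_fin, ← Finset.coe_image]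
    exact (finrank_span_finset_le_card _).trans Finset.card_image_le

/-- The Fourier basis is mutually unbiased to the standard basis. -/
lemma exists_isUnbiasedBasis (ω : Finset Y) :
    ∃ ξ : Fin ω.card → Y → ℂ, IsUnbiasedBasis ω ξ := by
  rcases Nat.eq_zero_or_pos ω.card with h0 | hpos
  · have : IsEmpty (Fin ω.card) := by rw [h0]; infer_instance
    exact ⟨fun _ => 0, isUnbiasedBasis_of_orthonormal (fun i => isEmptyElim i)
      (fun i => isEmptyElim i) (fun i => isEmptyElim i)⟩
  set k := ω.card with hk
  have hk0 : (k : ℝ) ≠ 0 := by exact_mod_cast hpos.ne'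
  set ζ : ℂ := Complex.exp (2 * Real.pi * Complex.I / k) with hζdef
  have hζ : IsPrimitiveRoot ζ k := Complex.isPrimitiveRoot_exp k hpos.ne'
  have hnorm : ‖ζ‖ = 1 := hζ.norm'_eq_one hpos.ne'
  have hconj : star ζ * ζ = 1 := by
    rw [RCLike.star_def, Complex.conj_mul', hnorm]
    simp
  have hsq : ((Real.sqrt k : ℝ) : ℂ) * (Real.sqrt k : ℝ) = k := by
    exact_mod_cast Real.mul_self_sqrt (Nat.cast_nonneg k)
  let e : ω ≃ Fin k := ω.equivFin
  let F : Fin k → Fin k → ℂ := fun j l => ζ ^ ((j : ℕ) * l) / (Real.sqrt k : ℝ)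
  have hF : ∀ i j, ∑ l, star (F i l) * F j l = if i = j then 1 else 0 := by
    intro i j
    have hterm : ∀ l, star (F i l) * F j l = (star ζ ^ (i : ℕ) * ζ ^ (j : ℕ)) ^ (l : ℕ) / k := by
      intro l
      simp only [F, star_div₀, star_pow, RCLike.star_def, Complex.conj_ofReal]
      rw [div_mul_div_comm, hsq, mul_pow, pow_mul, pow_mul]
    simp only [hterm]
    rw [← Finset.sum_div, Fin.sum_univ_eq_sum_range
      (fun l => (star ζ ^ (i : ℕ) * ζ ^ (j : ℕ)) ^ l) k]
    split_ifs with hij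
    · rw [hij, ← mul_pow, hconj]
      have : (k : ℂ) ≠ 0 := by exact_mod_cast hk0
      simp [this]
    · set z := star ζ ^ (i : ℕ) * ζ ^ (j : ℕ) with hz
      have hzk : z ^ k = 1 := by
        rw [hz, mul_pow, ← pow_mul, ← pow_mul, mul_comm _ k, mul_comm _ k, pow_mul, pow_mul,
          ← star_pow, hζ.pow_eq_one]
        simp
      have hz1 : z - 1 ≠ 0 := by
        intro h
        have h1 : z = 1 := sub_eq_zero.1 h
        have h2 : ζ ^ (i : ℕ) = ζ ^ (j : ℕ) := by
          calc ζ ^ (i : ℕ) = ζ ^ (i : ℕ) * z := by rw [h1, mul_one]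
            _ = (star ζ * ζ) ^ (i : ℕ) * ζ ^ (j : ℕ) := by rw [hz, mul_pow]; ring
            _ = ζ ^ (j : ℕ) := by rw [hconj, one_pow, one_mul]
        exact hij (Fin.ext (hζ.pow_inj i.2 j.2 h2))
      have hg := geom_sum_mul z k
      rw [hzk, sub_self] at hg
      rw [(mul_eq_zero.1 hg).resolve_right hz1, zero_div]
  refine ⟨fun j x => if hx : x ∈ ω then F j (e ⟨x, hx⟩) else 0,
    isUnbiasedBasis_of_orthonormal (fun i j => ?_) (fun j x hx => dif_neg hx) fun j x hx => ?_⟩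
  · rw [← hF i j, dotProduct, ← Equiv.sum_comp e,
      ← Finset.sum_subset (Finset.subset_univ ω)]
    · rw [← Finset.sum_attach]
      exact Finset.sum_congr rfl fun x _ => by simp
    · intro x _ hx
      simp [hx]
  · simp only [hx, dif_pos, F]
    rw [norm_div, norm_pow, hnorm, one_pow, div_pow, one_pow, Complex.norm_real, Real.norm_eq_abs,
      sq_abs, Real.sq_sqrt (Nat.cast_nonneg k)]

end UnbiasedBases

section MethodOfTypes

variable {X : Type*} [Fintype X] [DecidableEq X]

lemma numTypes_eq_card_image [DecidableEq (X → ℝ)] (n : ℕ) :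
    numTypes X n = (Finset.univ.image (empirical : (Fin n → X) → X → ℝ)).card := by
  rw [numTypes, ← Set.ncard_coe_finset]
  simp

lemma prod_eq_of_empirical_eq (lam : X → ℝ) {n : ℕ} {x y : Fin n → X}
    (h : empirical x = empirical y) : ∏ k, lam (x k) = ∏ k, lam (y k) := by
  rcases Nat.eq_zero_or_pos n with rfl | hn
  · simp
  have hcount : ∀ x : Fin n → X, ∏ k, lam (x k) =
      ∏ z, lam z ^ (Finset.univ.filter fun k => x k = z).card := by
    intro x
    rw [← Finset.prod_fiberwise Finset.univ x]
    refine Finset.prod_congr rfl fun z _ => ?_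
    rw [← Finset.prod_const]
    exact Finset.prod_congr rfl fun k hk => by rw [(Finset.mem_filter.1 hk).2]
  rw [hcount x, hcount y]
  refine Finset.prod_congr rfl fun z _ => ?_
  have hz := congrFun h z
  have hn' : (n : ℝ) ≠ 0 := by exact_mod_cast hn.ne'
  simp only [empirical, div_left_inj' hn', Nat.cast_inj] at hz
  rw [hz]

lemma sum_prod_eq_one {lam : X → ℝ} (hsum : ∑ x, lam x = 1) (n : ℕ) :
    ∑ x : Fin n → X, ∏ k, lam (x k) = 1 := by
  rw [← Fintype.piFinset_univ, ← Finset.prod_univ_sum]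
  simp [hsum]

lemma card_mul_rpow_le {lam : X → ℝ} (hlam : ∀ x, 0 ≤ lam x) {n : ℕ} (C : Finset (Fin n → X))
    {a : ℝ} (ha : 0 < a) (hC : ∀ x ∈ C, ∏ k, lam (x k) = a) (t : ℝ) :
    C.card * a ^ t ≤ (∑ x with lam x ≠ 0, lam x ^ t) ^ n := by
  have hpow : (∑ x with lam x ≠ 0, lam x ^ t) ^ n =
      ∑ x : Fin n → X, ∏ k, if lam (x k) ≠ 0 then lam (x k) ^ t else 0 := by
    rw [← Fintype.piFinset_univ,
      ← Finset.prod_univ_sum (fun _ : Fin n => (Finset.univ : Finset X))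
        (fun _ z => if lam z ≠ 0 then lam z ^ t else 0), Finset.prod_const, Finset.card_univ,
      Fintype.card_fin, Finset.sum_filter]
  have hnn : ∀ x : Fin n → X, 0 ≤ ∏ k, if lam (x k) ≠ 0 then lam (x k) ^ t else 0 := fun x =>
    Finset.prod_nonneg fun k _ => by
      split_ifs
      exacts [Real.rpow_nonneg (hlam _) _, le_rfl]
  rw [hpow, ← nsmul_eq_mul, ← Finset.sum_const]
  refine le_trans (Finset.sum_le_sum fun x hx => ?_)
    (Finset.sum_le_sum_of_subset_of_nonneg (Finset.subset_univ C) fun x _ _ => hnn x)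
  have hne : ∀ k, lam (x k) ≠ 0 := fun k h =>
    ha.ne' ((hC x hx).symm.trans (Finset.prod_eq_zero (Finset.mem_univ k) h))
  simp only [hne, ne_eq, not_false_eq_true, if_true]
  rw [← hC x hx, Real.finsetProd_rpow _ _ fun k _ => hlam (x k)]

/-- The size times the probability of a class of equiprobable sequences, in terms of the Rényi
entropy. -/
lemma card_mul_prob_le {lam : X → ℝ} (hlam : ∀ x, 0 ≤ lam x) (hsum : ∑ x, lam x = 1) {n : ℕ}
    (C : Finset (Fin n → X)) {a : ℝ} (ha : 0 < a) (hC : ∀ x ∈ C, ∏ k, lam (x k) = a)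
    (hC0 : 0 < C.card) {r s : ℝ} (hs1 : s < 1)
    (hr : -(s * (n * r)) ≤ s * Real.log (C.card * a)) :
    C.card * (C.card * a) ≤
      Real.exp (-(n * (-2 * s / (1 - s) * r - renyi lam ((1 + s) / 2)))) := by
  have hN : (0 : ℝ) < C.card := by exact_mod_cast hC0
  have h1s : 0 < 1 - s := by linarith
  set L := ∑ x with lam x ≠ 0, lam x ^ ((1 + s) / 2) with hL
  have hL0 : 0 < L := by
    refine Finset.sum_pos (fun x hx => Real.rpow_pos_of_pos
      ((hlam x).lt_of_ne (Finset.mem_filter.1 hx).2.symm) _) ?_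
    by_contra h
    rw [Finset.not_nonempty_iff_eq_empty, Finset.filter_eq_empty_iff] at h
    have : ∑ x, lam x = 0 := Finset.sum_eq_zero fun x hx => not_not.1 (h hx)
    linarith
  have hlog : Real.log C.card + (1 + s) / 2 * Real.log a ≤ n * Real.log L := by
    have h := Real.log_le_log (by positivity) (card_mul_rpow_le hlam C ha hC ((1 + s) / 2))
    rwa [Real.log_mul hN.ne' (Real.rpow_pos_of_pos ha _).ne', Real.log_rpow ha,
      Real.log_pow] at h
  rw [← Real.log_le_iff_le_exp (by positivity), Real.log_mul hN.ne' (by positivity)]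
  rw [Real.log_mul hN.ne' ha.ne'] at hr ⊢
  have hren : renyi lam ((1 + s) / 2) = 2 * Real.log L / (1 - s) := by
    rw [renyi, if_neg (by intro h; linarith), ← hL]
    rw [div_eq_div_iff (by intro h; linarith) h1s.ne']
    ring
  rw [hren]
  have e : -((n : ℝ) * (-2 * s / (1 - s) * r - 2 * Real.log L / (1 - s))) =
      (2 * (s * (n * r)) + 2 * (n * Real.log L)) / (1 - s) := by
    field_simp
    ring
  rw [e, le_div_iff₀ h1s]
  linarith

lemma le_exp_hoeffdingExponent {lam : X → ℝ} {n : ℕ} (hn : 0 < n) {c r : ℝ} (hc : 0 < c)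
    (h : ∀ s : ℝ, 0 ≤ s → s < 1 →
      c ≤ Real.exp (-(n * (-2 * s / (1 - s) * r - renyi lam ((1 + s) / 2))))) :
    c ≤ (EReal.exp (-((n : EReal) * hoeffdingExponent lam r))).toReal := by
  have hn' : (0 : ℝ) < n := by exact_mod_cast hn
  have hle : hoeffdingExponent lam r ≤ ((-Real.log c / n : ℝ) : EReal) := by
    refine iSup_le fun s => EReal.coe_le_coe_iff.2 ?_
    have h1 := (Real.log_le_iff_le_exp hc).2 (h s s.2.1 s.2.2)
    rw [le_div_iff₀ hn']
    linarith
  have hge : ((-2 * (0 : ℝ) / (1 - 0) * r - renyi lam ((1 + 0) / 2) : ℝ) : EReal) ≤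
      hoeffdingExponent lam r :=
    le_iSup (fun s : Set.Ico (0 : ℝ) 1 =>
      ((-2 * (s : ℝ) / (1 - s) * r - renyi lam ((1 + s) / 2) : ℝ) : EReal)) ⟨0, by simp⟩
  have htop : hoeffdingExponent lam r ≠ ⊤ := (hle.trans_lt (EReal.coe_lt_top _)).ne
  have hbot : hoeffdingExponent lam r ≠ ⊥ := ((EReal.bot_lt_coe _).trans_le hge).ne'
  lift hoeffdingExponent lam r to ℝ using ⟨htop, hbot⟩ with E
  rw [EReal.coe_le_coe_iff, le_div_iff₀ hn'] at hle
  have : -((n : EReal) * (E : EReal)) = ((-(n * E) : ℝ) : EReal) := by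
    push_cast
    rfl
  rw [this, EReal.exp_coe, ENNReal.toReal_ofReal (Real.exp_nonneg _),
    ← Real.log_le_iff_le_exp hc]
  linarith

end MethodOfTypes

section ErrorBounds

variable {X : Type*} [Fintype X] [DecidableEq X]

/-- The protocol that keeps exactly the types of probability more than `θ`. -/
theorem exists_protocol {dA dB : ℕ} {eA : X → Fin dA → ℂ} {eB : X → Fin dB → ℂ}
    (heA : IsOrthonormal eA) (heB : IsOrthonormal eB)
    {lam : X → ℝ} (hlam : ∀ x, 0 ≤ lam x) (hsum : ∑ x, lam x = 1) (n : ℕ) {θ M : ℝ}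
    (hθ : 0 ≤ θ) (hM : 0 ≤ M)
    (hbound : ∀ (C : Finset (Fin n → X)) (a : ℝ), 0 < C.card → 0 < a →
      (∀ x ∈ C, ∏ k, lam (x k) = a) → θ < C.card * a → C.card * a ≤ 1 →
      C.card * (C.card * a) ≤ M) :
    ∃ m : Finset (Fin n → X) → (Fin n → X) → ℝ, IsMeasureCollection m ∧
      (∃ ξ : (ω : Finset (Fin n → X)) → Fin ω.card → (Fin n → X) → ℂ,
        ∀ ω, IsUnbiasedBasis ω (ξ ω)) ∧
      ∀ ξ : (ω : Finset (Fin n → X)) → Fin ω.card → (Fin n → X) → ℂ,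
        (∀ ω, IsUnbiasedBasis ω (ξ ω)) →
        typeTwoError (densityPow n (rhoMix (Fin dA) (Fin dB)))
            (protocolTest (ketPow n eA) (ketPow n eB)
              (statePow n (schmidtVector eA eB lam)) m ξ)
          ≤ 4 * (numTypes X n : ℝ) ^ 3 * (((dA : ℝ) * dB) ^ n)⁻¹ * M ∧
        typeOneError (statePow n (schmidtVector eA eB lam))
            (protocolTest (ketPow n eA) (ketPow n eB)
              (statePow n (schmidtVector eA eB lam)) m ξ)
          ≤ numTypes X n * θ ∧
        0 ≤ typeOneError (statePow n (schmidtVector eA eB lam))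
            (protocolTest (ketPow n eA) (ketPow n eB)
              (statePow n (schmidtVector eA eB lam)) m ξ) := by
  classical
  set p : (Fin n → X) → ℝ := fun x => ∏ k, lam (x k) with hpdef
  have hp : ∀ x, 0 ≤ p x := fun x => Finset.prod_nonneg fun k _ => hlam _
  have hp1 : ∑ x, p x = 1 := sum_prod_eq_one hsum n
  have hf : ∀ x y : Fin n → X, empirical x = empirical y → p x = p y := fun x y h =>
    prod_eq_of_empirical_eq lam h
  set w : (X → ℝ) → ℝ := fun i => ∑ x with empirical x = i, p x with hw
  obtain ⟨m, hm0, hmsupp, hmsum, hcost⟩ := achievable_fibres (θ := θ) hp hp1 empirical hf hM (by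
    intro i hi
    set C := Finset.univ.filter fun x : Fin n → X => empirical x = i with hC
    have hCne : C.Nonempty := by
      by_contra h
      rw [Finset.not_nonempty_iff_eq_empty] at h
      rw [h, Finset.sum_empty] at hi
      linarith
    obtain ⟨x₀, hx₀⟩ := hCne
    have hconst : ∀ x ∈ C, p x = p x₀ := fun x hx =>
      hf x x₀ ((Finset.mem_filter.1 hx).2.trans (Finset.mem_filter.1 hx₀).2.symm)
    have hwC : ∑ x ∈ C, p x = C.card * p x₀ := by
      rw [Finset.sum_congr rfl hconst, Finset.sum_const, nsmul_eq_mul]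
    have hle : ∑ x ∈ C, p x ≤ 1 := by
      rw [← hp1]
      exact Finset.sum_le_sum_of_subset_of_nonneg (Finset.subset_univ C) fun x _ _ => hp x
    rw [hwC] at hi hle ⊢
    have hpos : 0 < p x₀ := by
      refine (hp x₀).lt_of_ne fun h => ?_
      rw [← h, mul_zero] at hi
      linarith
    exact hbound C (p x₀) (Finset.card_pos.2 ⟨x₀, hx₀⟩) hpos hconst hi hle)
  have hm : IsMeasureCollection m := ⟨hm0, fun x => by
    rw [hmsum]
    beta_reduce
    split_ifs
    exacts [le_rfl, zero_le_one], hmsupp⟩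
  refine ⟨m, hm, ⟨fun ω => (exists_isUnbiasedBasis ω).choose,
    fun ω => (exists_isUnbiasedBasis ω).choose_spec⟩, fun ξ hξ => ?_⟩
  have heA' := isOrthonormal_ketPow heA n
  have heB' := isOrthonormal_ketPow heB n
  have hone : typeOneError (statePow n (schmidtVector eA eB lam))
      (protocolTest (ketPow n eA) (ketPow n eB) (statePow n (schmidtVector eA eB lam)) m ξ) =
      ∑ i ∈ Finset.univ.image (empirical : (Fin n → X) → X → ℝ), if θ < w i then 0 else w i := by
    rw [typeOneError, statePow_schmidtVector eA eB hlam, sub_mulVec, one_mulVec, dotProduct_sub,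
      schmidtVector_norm heA' heB' hp, expectation_protocolTest heA' heB' hp hm hξ,
      ← Complex.ofReal_sub, Complex.ofReal_re, Finset.sum_comm, ← Finset.sum_sub_distrib]
    have hx : ∀ x, p x - ∑ ω, m ω x * p x = if θ < w (empirical x) then 0 else p x := by
      intro x
      rw [← Finset.sum_mul, hmsum]
      change p x - (if θ < w (empirical x) then 1 else 0) * p x = _
      split_ifs <;> simp
    rw [Finset.sum_congr rfl fun x _ => hx x,
      ← Finset.sum_fiberwise_of_maps_to (t := Finset.univ.image empirical)
      (fun x _ => Finset.mem_image_of_mem empirical (Finset.mem_univ x))]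
    refine Finset.sum_congr rfl fun i _ => ?_
    rw [Finset.sum_congr rfl fun x (hx : x ∈ Finset.univ.filter fun x => empirical x = i) => by
      rw [(Finset.mem_filter.1 hx).2]]
    split_ifs <;> simp [hw]
  refine ⟨?_, ?_, ?_⟩
  · rw [typeTwoError, statePow_schmidtVector eA eB hlam, rhoMix, densityPow_smul_one,
      Matrix.mul_smul, Matrix.mul_one, trace_smul, trace_protocolTest heA' heB' hp hm hξ,
      smul_eq_mul, Fintype.card_fin, Fintype.card_fin]
    have : ((dA : ℂ) * dB)⁻¹ ^ n * ((∑ ω, traceCost p ω (m ω) : ℝ) : ℂ) =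
        (((((dA : ℝ) * dB) ^ n)⁻¹ * ∑ ω, traceCost p ω (m ω) : ℝ) : ℂ) := by
      push_cast
      rw [inv_pow]
    rw [this, Complex.ofReal_re]
    calc (((dA : ℝ) * dB) ^ n)⁻¹ * ∑ ω, traceCost p ω (m ω)
        ≤ (((dA : ℝ) * dB) ^ n)⁻¹ * (4 * (numTypes X n : ℝ) ^ 3 * M) := by
          refine mul_le_mul_of_nonneg_left ?_ (by positivity)
          rwa [numTypes_eq_card_image]
      _ = _ := by ring
  · rw [hone, numTypes_eq_card_image, ← nsmul_eq_mul]
    refine Finset.sum_le_card_nsmul _ _ _ fun i _ => ?_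
    split_ifs with h
    exacts [hθ, not_lt.1 h]
  · rw [hone]
    refine Finset.sum_nonneg fun i _ => ?_
    split_ifs
    exacts [le_rfl, Finset.sum_nonneg fun x _ => hp x]

end ErrorBounds

end

end LocalTest

theorem mainTheorem6 {X : Type*} [Fintype X] [DecidableEq X] (dA dB : ℕ)
    (eA : X → Fin dA → ℂ) (eB : X → Fin dB → ℂ)
    (heA : LocalTest.IsOrthonormal eA) (heB : LocalTest.IsOrthonormal eB)
    (lam : X → ℝ) (hlam : ∀ x, 0 ≤ lam x) (hsum : ∑ x, lam x = 1)
    (Ψ : Fin dA × Fin dB → ℂ) (hΨ : Ψ = LocalTest.schmidtVector eA eB lam) :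
    (∀ r : ℝ, r < -(1 / 4) * deriv (LocalTest.renyi lam) (1 / 2) → ∀ n : ℕ,
      ∃ m : Finset (Fin n → X) → (Fin n → X) → ℝ, LocalTest.IsMeasureCollection m ∧
        (∃ ξ : (ω : Finset (Fin n → X)) → Fin ω.card → (Fin n → X) → ℂ,
          ∀ ω, LocalTest.IsUnbiasedBasis ω (ξ ω)) ∧
        ∀ ξ : (ω : Finset (Fin n → X)) → Fin ω.card → (Fin n → X) → ℂ,
          (∀ ω, LocalTest.IsUnbiasedBasis ω (ξ ω)) →
          LocalTest.typeTwoError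
              (LocalTest.densityPow n (LocalTest.rhoMix (Fin dA) (Fin dB)))
              (LocalTest.protocolTest (LocalTest.ketPow n eA) (LocalTest.ketPow n eB)
                (LocalTest.statePow n Ψ) m ξ)
            ≤ 4 * (LocalTest.numTypes X n : ℝ) ^ 3 * (((dA : ℝ) * dB) ^ n)⁻¹ *
              (EReal.exp (-((n : EReal) * LocalTest.hoeffdingExponent lam r))).toReal ∧
          LocalTest.typeOneError (LocalTest.statePow n Ψ)
              (LocalTest.protocolTest (LocalTest.ketPow n eA) (LocalTest.ketPow n eB)
                (LocalTest.statePow n Ψ) m ξ)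
            ≤ (LocalTest.numTypes X n : ℝ) * Real.exp (-(n * r))) ∧
    (∀ n : ℕ,
      ∃ m : Finset (Fin n → X) → (Fin n → X) → ℝ, LocalTest.IsMeasureCollection m ∧
        (∃ ξ : (ω : Finset (Fin n → X)) → Fin ω.card → (Fin n → X) → ℂ,
          ∀ ω, LocalTest.IsUnbiasedBasis ω (ξ ω)) ∧
        ∀ ξ : (ω : Finset (Fin n → X)) → Fin ω.card → (Fin n → X) → ℂ,
          (∀ ω, LocalTest.IsUnbiasedBasis ω (ξ ω)) →
          LocalTest.typeTwoError
              (LocalTest.densityPow n (LocalTest.rhoMix (Fin dA) (Fin dB)))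
              (LocalTest.protocolTest (LocalTest.ketPow n eA) (LocalTest.ketPow n eB)
                (LocalTest.statePow n Ψ) m ξ)
            ≤ 4 * (LocalTest.numTypes X n : ℝ) ^ 3 * (((dA : ℝ) * dB) ^ n)⁻¹ *
              Real.exp (n * LocalTest.renyi lam (1 / 2)) ∧
          LocalTest.typeOneError (LocalTest.statePow n Ψ)
              (LocalTest.protocolTest (LocalTest.ketPow n eA) (LocalTest.ketPow n eB)
                (LocalTest.statePow n Ψ) m ξ) = 0) := by
  subst hΨ
  constructor
  · intro r _ n
    obtain ⟨m, hm, hξ, h⟩ := LocalTest.exists_protocol heA heB hlam hsum n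
      (Real.exp_pos (-(n * r))).le
      (ENNReal.toReal_nonneg
        (a := EReal.exp (-((n : EReal) * LocalTest.hoeffdingExponent lam r))))
      (fun C a hC0 ha hC hθ h1 => by
        have hN : (0 : ℝ) < C.card := by exact_mod_cast hC0
        have hn : 0 < n := by
          rcases Nat.eq_zero_or_pos n with rfl | hn
          · norm_num at hθ
            linarith
          · exact hn
        have hlog : -(n * r) ≤ Real.log (C.card * a) :=
          ((Real.lt_log_iff_exp_lt (by positivity)).2 hθ).le
        refine LocalTest.le_exp_hoeffdingExponent hn (by positivity) fun s hs0 hs1 =>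
          LocalTest.card_mul_prob_le hlam hsum C ha hC hC0 hs1 ?_
        rw [← mul_neg]
        exact mul_le_mul_of_nonneg_left hlog hs0)
    exact ⟨m, hm, hξ, fun ξ hu => ⟨(h ξ hu).1, (h ξ hu).2.1⟩⟩
  · intro n
    obtain ⟨m, hm, hξ, h⟩ := LocalTest.exists_protocol heA heB hlam hsum n le_rfl
      (Real.exp_nonneg (n * LocalTest.renyi lam (1 / 2)))
      (fun C a hC0 ha hC _ _ => by
        have h := LocalTest.card_mul_prob_le hlam hsum C ha hC hC0 (r := 0) zero_lt_one (by simp)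
        simpa using h)
    refine ⟨m, hm, hξ, fun ξ hu => ⟨(h ξ hu).1, le_antisymm ?_ (h ξ hu).2.2⟩⟩
    simpa using (h ξ hu).2.1
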